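/- **Conventions.** An algebraic language consists of operation symbols of positive finite arity (constants are regarded as constant unary operations), and algebras are nonempty. A *logic* $\vdash$ is a consequence relation $\Gamma\vdash\varphi$ (reflexive, monotone, satisfying cut, not necessarily finitary), invariant under substitutions, on the set of formulas of an algebraic language $\mathscr L_\vdash$ over an infinite set of variables. A matrix $\langle A,F\rangle$ ($A$ an $\mathscr L_\vdash$-algebra, $F\subseteq A$) is a *model* of $\vdash$, and $F$ is a *deductive filter* of $\vdash$ on $A$, if $\Gamma\vdash\varphi$ and $h[\Gamma]\subseteq F$ imply $h(\varphi)\in F$ for every homomorphism $h$ from the formula algebra to $A$. The *Leibniz congruence* $\Omega^A F$ is the largest congruence of $A$ for which $F$ is a union of classes. $\mathrm{Mod}^{\equiv}(\vdash)$ is the class of models $\langle A,F\rangle$ of $\vdash$ such that $\bigcap\{\Omega^A G : G \text{ a deductive filter of } \vdash \text{ on } A,\ F\subseteq G\}$ is the identity relation. A *translation* $\tau$ of $\mathscr L$ into $\mathscr L'$ assigns to each $n$-ary symbol of $\mathscr L$ a formula of $\mathscr L'$ in the variables $x_1,\dots,x_n$; for an $\mathscr L'$-algebra $A$, let $A^\tau$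 be the $\mathscr L$-algebra on the same universe in which each symbol $f$ is interpreted as the term function of $\tau(f)$. Write ${\vdash}\le{\vdash'}$ if there is a translation $\tau$ of $\mathscr L_{\vdash}$ into $\mathscr L_{\vdash'}$ such that $\langle A,F\rangle\in\mathrm{Mod}^{\equiv}(\vdash')$ implies $\langle A^\tau,F\rangle\in\mathrm{Mod}^{\equiv}(\vdash)$. This is a preorder; let $\mathsf{Log}$ be the associated poset of equivalence classes $[\![\vdash]\!]$. A logic $\vdash$ is *meet-prime* if $[\![\vdash]\!]$ is meet-prime in $\mathsf{Log}$: for all $b,c\in\mathsf{Log}$, if $b\wedge c\le[\![\vdash]\!]$ (that is, every common lower bound of $b$ and $c$ is below $[\![\vdash]\!]$), then $b\le[\![\vdash]\!]$ or $c\le[\![\vdash]\!]$. A *Leibniz condition* is a sequence $\Phi=\{\vdash_{\Phi_\alpha} : \alpha \text{ an ordinal}\}$ of logics such that ${\vdash_{\Phi_\beta}}\le{\vdash_{\Phi_\alpha}}$ whenever $\alpha\le\beta$; $\mathrm{Log}(\Phi)$ is the class of logics $\vdash$ such that ${\vdash_{\Phi_\alpha}}\le{\vdash}$ for some ordinal $\alpha$.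 A logic $\vdash$ is *equivalential* if there is a nonempty set $\Delta(x,y)$ of formulas in two variables such that for every model $\langle A,F\rangle$ of $\vdash$ and all $a,b\in A$, $\langle a,b\rangle\in\Omega^A F$ if and only if $\Delta^A(a,b)\subseteq F$. For an infinite cardinal $\kappa$, the *basic equivalential logic* $\vdash_{\mathsf E}^{\kappa}$ of rank $\kappa$ is the logic in countably infinitely many variables, whose language consists of binary symbols $\multimap_\alpha$ ($\alpha<\kappa$), that is determined by the following rules, where $\Delta_\kappa(x,y)=\{x\multimap_\alpha y:\alpha<\kappa\}$ and a rule whose conclusion is a set stands for the rules whose conclusions are its members: $$\emptyset\rhd\Delta_\kappa(x,x),\qquad x,\Delta_\kappa(x,y)\rhd y,$$ $$\Delta_\kappa(x_1,y_1)\cup\Delta_\kappa(x_2,y_2)\rhd\Delta_\kappa(x_1\multimap_\alpha x_2,\;y_1\multimap_\alpha y_2)\quad(\alpha<\kappa).$$ **Theorem.** For every infinite cardinal $\kappa$, the logic $\vdash_{\mathsf E}^{\kappa}$ is meet-prime. Moreover, there is a Leibniz condition $\Phi$ all of whose members are meet-prime logics such that $\mathrm{Log}(\Phi)$ is the class of equivalential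 logics. -/

import Mathlib

universe u

namespace AAL

/-! Propositional logics, their matrix semantics, interpretability and Leibniz conditions. Sets are
the members of `Type u`; proper classes (of logics, of matrices, of ordinals) live one level up. -/

/-- An algebraic language is a first-order language without relation symbols. As is usual in the
study of interpretability, there are no symbols of arity `0`: constants are regarded as constant
unary operations. -/
class IsAlgebraicLanguage (L : FirstOrder.Language.{u, 0}) : Prop where
  noRelations : L.IsAlgebraic
  noConstants : IsEmpty (L.Functions 0)

/-- An `L`-algebra: a nonempty set with an interpretation of the operation symbols of `L`. -/
structure Alg (L : FirstOrder.Language.{u, 0}) where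
  carrier : Type u
  nonempty : Nonempty carrier
  str : L.Structure carrier

attribute [instance] Alg.nonempty Alg.str

/-- A (propositional) logic: a substitution-invariant consequence relation on the set of formulas
of an algebraic language, built up from an infinite set of variables. Monotonicity follows from
`refl` and `cut`. -/
structure Logic where
  lang : FirstOrder.Language.{u, 0}
  algebraic : IsAlgebraicLanguage lang
  Var : Type u
  infiniteVar : Infinite Var
  Entails : Set (lang.Term Var) → lang.Term Var → Prop
  refl : ∀ {Γ : Set (lang.Term Var)} {φ : lang.Term Var}, φ ∈ Γ → Entails Γ φ
  cut : ∀ {Γ Δ : Set (lang.Term Var)} {φ : lang.Term Var},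
    (∀ ψ ∈ Δ, Entails Γ ψ) → Entails Δ φ → Entails Γ φ
  structural : ∀ {Γ : Set (lang.Term Var)} {φ : lang.Term Var} (σ : Var → lang.Term Var),
    Entails Γ φ → Entails ((fun γ => γ.subst σ) '' Γ) (φ.subst σ)

section Congruences

variable {L : FirstOrder.Language.{u, 0}}

/-- `θ` is a congruence of the algebra `A`. -/
def IsCongruence (A : Alg L) (θ : Setoid A.carrier) : Prop :=
  ∀ (n : ℕ) (f : L.Functions n) (x y : Fin n → A.carrier),
    (∀ i, θ (x i) (y i)) → θ (FirstOrder.Language.Structure.funMap f x) (FirstOrder.Language.Structure.funMap f y)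

/-- `θ` is compatible with `F`: the set `F` is a union of classes of `θ`. -/
def IsCompatible (A : Alg L) (θ : Setoid A.carrier) (F : Set A.carrier) : Prop :=
  ∀ a b, θ a b → a ∈ F → b ∈ F

/-- The Leibniz congruence of `F` on `A`: the largest congruence of `A` compatible with `F`. -/
def leibniz (A : Alg L) (F : Set A.carrier) : Setoid A.carrier :=
  sSup {θ | IsCongruence A θ ∧ IsCompatible A θ F}

end Congruences

namespace Logic

/-- `⟨A, F⟩` is a model of the logic, that is, `F` is a deductive filter of the logic on `A`. -/
def IsModel (l : Logic.{u}) (A : Alg l.lang) (F : Set A.carrier) : Prop :=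
  ∀ (Γ : Set (l.lang.Term l.Var)) (φ : l.lang.Term l.Var), l.Entails Γ φ →
    ∀ v : l.Var → A.carrier, (∀ γ ∈ Γ, γ.realize v ∈ F) → φ.realize v ∈ F

/-- The Suszko congruence of `F` on `A` relative to the logic: the intersection of the Leibniz
congruences of the deductive filters containing `F`. -/
def suszko (l : Logic.{u}) (A : Alg l.lang) (F : Set A.carrier) : Setoid A.carrier :=
  sInf {θ | ∃ G : Set A.carrier, F ⊆ G ∧ l.IsModel A G ∧ θ = leibniz A G}

/-- `⟨A, F⟩` is a Suszko-reduced model of the logic, i.e. it belongs to `Mod^≡`: it is a model,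
and its Suszko congruence is the identity relation. -/
def IsReducedModel (l : Logic.{u}) (A : Alg l.lang) (F : Set A.carrier) : Prop :=
  l.IsModel A F ∧ l.suszko A F = ⊥

end Logic

/-- A translation of `L` into `L'` sends each `n`-ary symbol of `L` to a formula of `L'` in the
variables `x₁, …, xₙ`. -/
def Translation (L L' : FirstOrder.Language.{u, 0}) : Type u :=
  ∀ n : ℕ, L.Functions n → L'.Term (Fin n)

/-- The `L`-algebra `A^τ` on the universe of the `L'`-algebra `A` in which each symbol `f` of `L`
is interpreted as the term function of `τ(f)`. -/
def Translation.reduct {L L' : FirstOrder.Language.{u, 0}} [hL : IsAlgebraicLanguage L]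
    (τ : Translation L L') (A : Alg L') : Alg L where
  carrier := A.carrier
  nonempty := A.nonempty
  str :=
    { funMap := fun {n} f x => (τ n f).realize x
      RelMap := fun {n} r => ((hL.noRelations n).false r).elim }

namespace Logic

attribute [instance] Logic.algebraic Logic.infiniteVar

/-- `τ` is an interpretation of `l` into `l'`: whenever `⟨A, F⟩` is in `Mod^≡(l')`, the matrix
`⟨A^τ, F⟩` is in `Mod^≡(l)`. -/
def IsInterpretation (l l' : Logic.{u}) (τ : Translation l.lang l'.lang) : Prop :=
  ∀ (A : Alg l'.lang) (F : Set A.carrier),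
    l'.IsReducedModel A F → l.IsReducedModel (τ.reduct A) F

/-- `l` is interpretable into `l'`. -/
def Interpretable (l l' : Logic.{u}) : Prop :=
  ∃ τ : Translation l.lang l'.lang, l.IsInterpretation l' τ

theorem Interpretable.rfl' (l : Logic.{u}) : l.Interpretable l := by
  let τ : Translation l.lang l.lang := fun _ f => FirstOrder.Language.Term.func f FirstOrder.Language.Term.var
  refine ⟨τ, fun A F h => ?_⟩
  have hA : τ.reduct A = A := by
    obtain ⟨C, hC, S⟩ := A
    have hS : (τ.reduct ⟨C, hC, S⟩).str = S := by
      refine FirstOrder.Language.Structure.ext ?_ ?_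
      · funext n f x
        rfl
      · funext n r
        exact ((l.algebraic.noRelations n).false r).elim
    exact congrArg (Alg.mk C hC) hS
  have key : ∀ B : Alg l.lang, B = A → ∀ G : Set B.carrier, HEq G F → l.IsReducedModel B G := by
    rintro B rfl G hG
    rw [eq_of_heq hG]
    exact h
  exact key _ hA F HEq.rfl

theorem Interpretable.trans' {l₁ l₂ l₃ : Logic.{u}} (h₁ : l₁.Interpretable l₂)
    (h₂ : l₂.Interpretable l₃) : l₁.Interpretable l₃ := by
  obtain ⟨τ, hτ⟩ := h₁
  obtain ⟨ρ, hρ⟩ := h₂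
  let π : Translation l₁.lang l₃.lang := fun n f => (τ n f).substFunc fun {m} g => ρ m g
  refine ⟨π, fun A F h => ?_⟩
  have hA : π.reduct A = τ.reduct (ρ.reduct A) := by
    have hS : (π.reduct A).str = (τ.reduct (ρ.reduct A)).str := by
      refine FirstOrder.Language.Structure.ext ?_ ?_
      · funext n f x
        let _ : l₂.lang.Structure A.carrier := (ρ.reduct A).str
        exact FirstOrder.Language.Term.realize_substFunc (M := A.carrier)
          (c := fun {m} g => ρ m g) (fun _ _ => rfl) x (τ n f)
      · funext n r
        exact ((l₁.algebraic.noRelations n).false r).elim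
    exact congrArg (Alg.mk A.carrier A.nonempty) hS
  have h' := hτ (ρ.reduct A) F (hρ A F h)
  have key : ∀ B : Alg l₁.lang, B = τ.reduct (ρ.reduct A) → ∀ G : Set B.carrier, HEq G F →
      l₁.IsReducedModel B G := by
    rintro B rfl G hG
    rw [eq_of_heq hG]
    exact h'
  exact key _ hA F HEq.rfl

/-- The interpretability preorder on logics. -/
instance : Preorder Logic.{u} where
  le := Interpretable
  le_refl := Interpretable.rfl'
  le_trans _ _ _ := Interpretable.trans'

end Logic

/-- The poset of all logics: logics modulo equi-interpretability. -/
abbrev PosetLog : Type (u + 1) := Antisymmetrization Logic.{u} (· ≤ ·)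

/-- An element `a` of a poset is meet-prime if `b ∧ c ≤ a` implies `b ≤ a` or `c ≤ a`. The
inequality `b ∧ c ≤ a` is written out as: every common lower bound of `b` and `c` is below `a`. -/
def IsMeetPrime {P : Type*} [PartialOrder P] (a : P) : Prop :=
  ∀ b c : P, (∀ d : P, d ≤ b → d ≤ c → d ≤ a) → b ≤ a ∨ c ≤ a

/-- Where the meet of `b` and `c` exists, the premise in `IsMeetPrime` says that it is below `a`. -/
theorem forall_lowerBound_le_iff {P : Type*} [PartialOrder P] {a b c m : P}
    (hm : IsGLB {b, c} m) : (∀ d : P, d ≤ b → d ≤ c → d ≤ a) ↔ m ≤ a := by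
  constructor
  · intro h
    exact h m (hm.1 (by simp)) (hm.1 (by simp))
  · intro h d hb hc
    exact (hm.2 (by rintro x (rfl | rfl) <;> assumption)).trans h

/-- A logic is meet-prime if its class is meet-prime in the poset of all logics. -/
def Logic.MeetPrime (l : Logic.{u}) : Prop :=
  IsMeetPrime (toAntisymmetrization (· ≤ ·) l : PosetLog.{u})

/-- A Leibniz condition: a sequence of logics indexed by all ordinals such that
`Φ_β ≤ Φ_α` whenever `α ≤ β`. -/
structure LeibnizCondition where
  seq : Ordinal.{u} → Logic.{u}
  antitone : ∀ α β : Ordinal.{u}, α ≤ β → seq β ≤ seq α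

/-- The class `Log(Φ)` of the logics that satisfy the Leibniz condition `Φ`. -/
def LeibnizCondition.Log (Φ : LeibnizCondition.{u}) : Set Logic.{u} :=
  {l | ∃ α : Ordinal.{u}, Φ.seq α ≤ l}

/-- A logic is equivalential if it has a nonempty set `Δ(x, y)` of congruence formulas (without
parameters): in every model `⟨A, F⟩`, the Leibniz congruence of `F` relates `a` and `b` precisely
when `Δ(a, b) ⊆ F`. -/
def Logic.Equivalential (l : Logic.{u}) : Prop :=
  ∃ Δ : Set (l.lang.Term (Fin 2)), Δ.Nonempty ∧
    ∀ (A : Alg l.lang) (F : Set A.carrier), l.IsModel A F → ∀ a b : A.carrier,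
      leibniz A F a b ↔ ∀ δ ∈ Δ, δ.realize ![a, b] ∈ F

section Calculus

variable {L : FirstOrder.Language.{u, 0}} {V : Type u}

/-- Derivability from `Γ` by means of the substitution instances of the rules in `R`, where a rule
`Δ ▷ φ` is the pair `(Δ, φ)` and may have infinitely many premises. -/
inductive Derivable (R : Set (Set (L.Term V) × L.Term V)) (Γ : Set (L.Term V)) :
    L.Term V → Prop
  | hyp (φ : L.Term V) : φ ∈ Γ → Derivable R Γ φ
  | rule (Δ : Set (L.Term V)) (φ : L.Term V) (σ : V → L.Term V) : (Δ, φ) ∈ R →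
      (∀ ψ ∈ Δ, Derivable R Γ (ψ.subst σ)) → Derivable R Γ (φ.subst σ)

theorem Derivable.cut {R : Set (Set (L.Term V) × L.Term V)} {Γ Δ : Set (L.Term V)}
    {φ : L.Term V} (h : ∀ ψ ∈ Δ, Derivable R Γ ψ) (hφ : Derivable R Δ φ) : Derivable R Γ φ := by
  induction hφ with
  | hyp φ hφ => exact h φ hφ
  | rule Θ φ σ hR _ ih => exact Derivable.rule Θ φ σ hR ih

theorem subst_subst (t : L.Term V) (σ ρ : V → L.Term V) :
    (t.subst σ).subst ρ = t.subst fun x => (σ x).subst ρ := by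
  induction t with
  | var x => rfl
  | func f ts ih => simp only [FirstOrder.Language.Term.subst, ih]

theorem Derivable.subst {R : Set (Set (L.Term V) × L.Term V)} {Γ : Set (L.Term V)}
    {φ : L.Term V} (ρ : V → L.Term V) (hφ : Derivable R Γ φ) :
    Derivable R ((fun γ => γ.subst ρ) '' Γ) (φ.subst ρ) := by
  induction hφ with
  | hyp φ hφ => exact Derivable.hyp _ ⟨φ, hφ, rfl⟩
  | rule Θ φ σ hR _ ih =>
    rw [subst_subst]
    refine Derivable.rule Θ φ _ hR fun ψ hψ => ?_
    rw [← subst_subst]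
    exact ih ψ hψ

/-- The logic on the formulas of `L` in the variables `V` determined by the set of rules `R`: the
least logic on these formulas validating the rules in `R`. -/
abbrev Logic.ofRules (L : FirstOrder.Language.{u, 0}) [hL : IsAlgebraicLanguage L] (V : Type u)
    [hV : Infinite V] (R : Set (Set (L.Term V) × L.Term V)) : Logic.{u} where
  lang := L
  algebraic := hL
  Var := V
  infiniteVar := hV
  Entails := Derivable R
  refl := Derivable.hyp _
  cut := Derivable.cut
  structural := Derivable.subst

theorem Logic.ofRules_least (l : Logic.{u}) (R : Set (Set (l.lang.Term l.Var) × l.lang.Term l.Var))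
    (hR : ∀ r ∈ R, l.Entails r.1 r.2) {Γ : Set (l.lang.Term l.Var)} {φ : l.lang.Term l.Var}
    (h : Derivable R Γ φ) : l.Entails Γ φ := by
  induction h with
  | hyp φ hφ => exact l.refl hφ
  | rule Θ φ σ hr _ ih =>
    refine l.cut (Δ := (fun γ => γ.subst σ) '' Θ) ?_ (l.structural σ (hR _ hr))
    rintro _ ⟨ψ, hψ, rfl⟩
    exact ih ψ hψ

end Calculus

section BasicEquivalential

/-- The operation symbols of the language of the basic equivalential logic of rank `κ`: a set of
binary symbols of cardinality `κ`. -/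
def EqFunctions (κ : Cardinal.{u}) : ℕ → Type u
  | 2 => κ.out
  | _ => PEmpty

/-- The language of the basic equivalential logic of rank `κ`. -/
def eqLang (κ : Cardinal.{u}) : FirstOrder.Language.{u, 0} where
  Functions := EqFunctions κ
  Relations := fun _ => Empty

instance (κ : Cardinal.{u}) : IsAlgebraicLanguage (eqLang κ) where
  noRelations := fun _ => inferInstanceAs (IsEmpty Empty)
  noConstants := inferInstanceAs (IsEmpty PEmpty)

/-- The formulas of the basic equivalential logic, in countably many variables. -/
abbrev EqFm (κ : Cardinal.{u}) : Type u := (eqLang κ).Term (ULift.{u} ℕ)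

/-- The `i`-th variable. -/
def eqVar {κ : Cardinal.{u}} (i : ℕ) : EqFm κ := FirstOrder.Language.Term.var (ULift.up i)

/-- The binary symbol `⊸_α`. -/
def eqSymbol {κ : Cardinal.{u}} (α : κ.out) : (eqLang κ).Functions 2 := α

/-- The formula `φ ⊸_α ψ`. -/
def lolli {κ : Cardinal.{u}} (α : κ.out) (φ ψ : EqFm κ) : EqFm κ :=
  (eqSymbol α).apply₂ φ ψ

/-- The set of formulas `Δ_κ(φ, ψ) = {φ ⊸_α ψ : α < κ}`. -/
def eqDelta {κ : Cardinal.{u}} (φ ψ : EqFm κ) : Set (EqFm κ) :=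
  Set.range fun α : κ.out => lolli α φ ψ

/-- The rules of the basic equivalential logic of rank `κ`. A rule whose conclusion is a set of
formulas stands for the family of the rules with conclusion a member of that set. -/
inductive EqRules (κ : Cardinal.{u}) : Set (EqFm κ) × EqFm κ → Prop
  /-- `∅ ▷ Δ(x, x)` -/
  | refl (δ : EqFm κ) : δ ∈ eqDelta (κ := κ) (eqVar 0) (eqVar 0) → EqRules κ (∅, δ)
  /-- `x, Δ(x, y) ▷ y` -/
  | detach : EqRules κ ({eqVar 0} ∪ eqDelta (eqVar 0) (eqVar 1), eqVar 1)
  /-- `Δ(x₁, y₁) ∪ Δ(x₂, y₂) ▷ Δ(x₁ ⊸_α x₂, y₁ ⊸_α y₂)` -/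
  | replace (α : κ.out) (δ : EqFm κ) :
      δ ∈ eqDelta (lolli α (eqVar 0) (eqVar 2)) (lolli α (eqVar 1) (eqVar 3)) →
      EqRules κ (eqDelta (eqVar 0) (eqVar 1) ∪ eqDelta (eqVar 2) (eqVar 3), δ)

/-- The basic equivalential logic of rank `κ`. -/
abbrev basicEquivalential (κ : Cardinal.{u}) : Logic.{u} :=
  Logic.ofRules (eqLang κ) (ULift.{u} ℕ) {r | EqRules κ r}

end BasicEquivalential

end AAL

/-! Meet-primeness comes down to one fact: an idempotent binary term of the language of a basic
equivalential logic must be a variable. Given logics `l 0` and `l 1`, a lower bound `meetLogic l` is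
defined by matrices. Its symbols are those of both logics and a binary symbol `diag`. On a model of
`l i` the symbols of the other logic act as first projections, and `diag` as projection to
coordinate `i`. The full strength of a meet is not needed, since the premise of `IsMeetPrime` covers
every common lower bound.

The identity `diag(x, x) = x` passes to all reduced models of `meetLogic l`
(`IsReducedModel.realize_eq`). If τ interprets `meetLogic l` into a basic equivalential logic,
τ(`diag`) is therefore idempotent in every reduced model of the latter. One such model is a term
algebra (`isReducedModel_termAlg`), where a compound term cannot be idempotent. So τ(`diag`) is a
variable, `diag` selects a fixed coordinate `i`, and the symbols of `l i` then yield reduced models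
of `l i` (`isReducedModel_meetIncl`).

For the Leibniz condition, the members are the basic equivalential logics of ranks ℵ_α. Their
reduced models are the matrices in which Δ(a, b) ⊆ F means a = b. Interpreting one of them into a
logic thus amounts to giving that logic a family of congruence formulas, and every set of formulas
is small enough for some ℵ_α. -/

namespace AAL

open FirstOrder FirstOrder.Language

/-! ### Leibniz congruences, quotients and reducts -/

section Algebras

variable {L L' : FirstOrder.Language.{u, 0}}

/-- The value of a term depends only on the values of its variables. -/
theorem realize_congr_varFinset {X : Type*} [DecidableEq X] (A : Alg L) (t : L.Term X)
    {v w : X → A.carrier} (h : ∀ x ∈ t.varFinset, v x = w x) : t.realize v = t.realize w := by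
  induction t with
  | var x => exact h x (by simp [Term.varFinset])
  | func f ts ih =>
    simp only [Term.realize_func]
    congr 1
    funext i
    exact ih i fun x hx => h x (by simp only [Term.varFinset, Finset.mem_biUnion]; exact ⟨i, by simp, hx⟩)

/-- The operations of a congruence lift to term functions. -/
theorem IsCongruence.realize {A : Alg L} {θ : Setoid A.carrier} (hθ : IsCongruence A θ)
    {X : Type*} (t : L.Term X) {v w : X → A.carrier} (h : ∀ x, θ (v x) (w x)) :
    θ (t.realize v) (t.realize w) := by
  induction t with
  | var x => exact h x
  | func f ts ih => exact hθ _ f _ _ ih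

/-- The evaluation of the polynomial `p` of `A` (a term whose variables other than `none` are
elements of `A`) at `a`. -/
def polyEval (A : Alg L) (p : L.Term (Option A.carrier)) (a : A.carrier) : A.carrier :=
  p.realize fun o => o.elim a id

/-- Two elements are related if no polynomial separates them with respect to `F`. -/
def polyEquiv (A : Alg L) (F : Set A.carrier) : Setoid A.carrier where
  r a b := ∀ p, polyEval A p a ∈ F ↔ polyEval A p b ∈ F
  iseqv := ⟨fun _ _ => Iff.rfl, fun h p => (h p).symm, fun h k p => (h p).trans (k p)⟩

theorem polyEquiv_isCongruence (A : Alg L) (F : Set A.carrier) :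
    IsCongruence A (polyEquiv A F) := by
  classical
  intro n f x y h p
  -- The arguments are changed from x to y one coordinate at a time.
  have step : ∀ s : Finset (Fin n), polyEval A p (Structure.funMap f x) ∈ F ↔
      polyEval A p (Structure.funMap f (s.piecewise y x)) ∈ F := by
    intro s
    induction s using Finset.induction_on with
    | empty => simp
    | insert i s hi ih =>
      rw [ih]
      set w := s.piecewise y x with hw
      -- f with all arguments but the i-th frozen is a polynomial, and q is its composite with p.
      let q : L.Term (Option A.carrier) := p.subst fun o => o.elim
        (.func f fun j => if j = i then .var none else .var (some (w j))) fun c => .var (some c)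
      have hq : ∀ a, polyEval A q a = polyEval A p (Structure.funMap f (Function.update w i a)) := by
        intro a
        simp only [polyEval, q, Term.realize_subst]
        congr 1
        funext o
        cases o with
        | none =>
          simp only [Option.elim, Term.realize_func]
          congr 1
          funext j
          by_cases hj : j = i
          · subst hj; simp
          · simp [hj]
        | some c => rfl
      have h₁ : Function.update w i (x i) = w := by
        rw [Function.update_eq_self_iff, hw]
        simp [hi]
      have h₂ := h i q
      rw [hq, hq, h₁] at h₂
      rw [h₂, Finset.piecewise_insert]
  simpa using step Finset.univ

theorem polyEquiv_isCompatible (A : Alg L) (F : Set A.carrier) :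
    IsCompatible A (polyEquiv A F) F := fun _ _ h => (h (.var none)).1

/-- `leibniz` is a supremum of equivalence relations, so it is not clear at once that it belongs to
the family. It does: every compatible congruence lies below `polyEquiv`, which is itself one. -/
theorem leibniz_eq_polyEquiv (A : Alg L) (F : Set A.carrier) : leibniz A F = polyEquiv A F := by
  apply le_antisymm
  · refine sSup_le ?_
    rintro θ ⟨h₁, h₂⟩ a b hab p
    have : θ (polyEval A p a) (polyEval A p b) := by
      refine h₁.realize p fun o => ?_
      cases o with
      | none => exact hab
      | some c => exact θ.refl c
    exact ⟨h₂ _ _ this, h₂ _ _ (θ.symm this)⟩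
  · exact le_sSup ⟨polyEquiv_isCongruence A F, polyEquiv_isCompatible A F⟩

theorem leibniz_isCongruence (A : Alg L) (F : Set A.carrier) : IsCongruence A (leibniz A F) :=
  leibniz_eq_polyEquiv A F ▸ polyEquiv_isCongruence A F

theorem leibniz_isCompatible (A : Alg L) (F : Set A.carrier) : IsCompatible A (leibniz A F) F :=
  leibniz_eq_polyEquiv A F ▸ polyEquiv_isCompatible A F

theorem le_leibniz {A : Alg L} {F : Set A.carrier} {θ : Setoid A.carrier}
    (h₁ : IsCongruence A θ) (h₂ : IsCompatible A θ F) : θ ≤ leibniz A F :=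
  le_sSup ⟨h₁, h₂⟩

/-- The quotient of an algebra by a congruence. -/
noncomputable def quotientAlg (A : Alg L) [IsAlgebraicLanguage L] (θ : Setoid A.carrier) : Alg L where
  carrier := Quotient θ
  nonempty := A.nonempty.map (Quotient.mk θ)
  str :=
    { funMap := fun f x => Quotient.mk θ (Structure.funMap f fun i => (x i).out)
      RelMap := fun {n} r => ((IsAlgebraicLanguage.noRelations (L := L) n).false r).elim }

theorem realize_quotientAlg {A : Alg L} [IsAlgebraicLanguage L] {θ : Setoid A.carrier}
    (hθ : IsCongruence A θ) {X : Type*} (t : L.Term X) (v : X → A.carrier) :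
    t.realize (M := (quotientAlg A θ).carrier) (fun x => Quotient.mk θ (v x)) =
      Quotient.mk θ (t.realize v) := by
  induction t with
  | var x => rfl
  | func f ts ih =>
    refine Quotient.sound (hθ _ f _ _ fun i => ?_)
    exact Quotient.exact ((Quotient.out_eq _).trans (ih i))

/-- The class of `a` lies in the image of a compatible set only if `a` lies in the set. -/
theorem mk_mem_image_iff {A : Alg L} {θ : Setoid A.carrier} {F : Set A.carrier}
    (hF : IsCompatible A θ F) {a : A.carrier} : Quotient.mk θ a ∈ Quotient.mk θ '' F ↔ a ∈ F := by
  constructor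
  · rintro ⟨b, hb, hab⟩
    exact hF b a (Quotient.exact hab) hb
  · exact fun h => ⟨a, h, rfl⟩

/-- Modulo the Leibniz congruence the Leibniz congruence becomes the identity. -/
theorem leibniz_quotientAlg [IsAlgebraicLanguage L] (A : Alg L) (F : Set A.carrier) :
    leibniz (quotientAlg A (leibniz A F)) (Quotient.mk (leibniz A F) '' F) = ⊥ := by
  have hc := leibniz_isCongruence A F
  set B := quotientAlg A (leibniz A F) with hB
  set G : Set B.carrier := Quotient.mk (leibniz A F) '' F with hG
  rw [eq_bot_iff]
  intro x y hxy
  induction x using Quotient.inductionOn with | _ a => ?_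
  induction y using Quotient.inductionOn with | _ b => ?_
  refine Quotient.sound ?_
  -- Pulled back to A, the Leibniz congruence of the quotient is again a congruence compatible with
  -- F.
  let θ : Setoid A.carrier := (leibniz B G).comap (Quotient.mk (leibniz A F))
  have hθ : θ ≤ leibniz A F := by
    refine le_leibniz ?_ ?_
    · intro n f v w h
      change leibniz B G _ _
      have e : ∀ v : Fin n → A.carrier, Quotient.mk (leibniz A F) (Structure.funMap f v) =
          Structure.funMap (M := B.carrier) f fun i => Quotient.mk (leibniz A F) (v i) := fun v =>
        (realize_quotientAlg hc (.func f .var) v).symm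
      rw [e, e]
      exact leibniz_isCongruence B G n f _ _ h
    · intro c d h hd
      exact (mk_mem_image_iff (leibniz_isCompatible A F)).1
        (leibniz_isCompatible B G _ _ h ⟨c, hd, rfl⟩)
  exact hθ hxy

/-- Translating a term amounts to evaluating it in the reduct. -/
theorem realize_substFunc_reduct [IsAlgebraicLanguage L] (τ : Translation L L') (A : Alg L')
    {X : Type*} (t : L.Term X) (v : X → A.carrier) :
    (t.substFunc fun {n} f => τ n f).realize v =
      t.realize (M := (τ.reduct A).carrier) v := by
  let _ : L.Structure A.carrier := (τ.reduct A).str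
  exact Term.realize_substFunc (M := A.carrier) (c := fun {m} g => τ m g) (fun _ _ => rfl) v t

/-- The composition of two translations. -/
def Translation.comp {L'' : FirstOrder.Language.{u, 0}} (τ : Translation L L')
    (ρ : Translation L' L'') : Translation L L'' :=
  fun n f => (τ n f).substFunc fun {m} g => ρ m g

theorem reduct_comp {L'' : FirstOrder.Language.{u, 0}} [IsAlgebraicLanguage L]
    [IsAlgebraicLanguage L'] (τ : Translation L L') (ρ : Translation L' L'') (A : Alg L'') :
    (τ.comp ρ).reduct A = τ.reduct (ρ.reduct A) := by
  have hS : ((τ.comp ρ).reduct A).str = (τ.reduct (ρ.reduct A)).str := by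
    refine Structure.ext ?_ ?_
    · funext n f x
      exact realize_substFunc_reduct ρ A (τ n f) x
    · funext n r
      exact ((IsAlgebraicLanguage.noRelations (L := L) n).false r).elim
  exact congrArg (Alg.mk A.carrier A.nonempty) hS

end Algebras

/-! ### Reduced models and logics of matrices -/

namespace Logic

variable {l : Logic.{u}}

theorem suszko_iff {A : Alg l.lang} {F : Set A.carrier} {a b : A.carrier} :
    l.suszko A F a b ↔ ∀ G, F ⊆ G → l.IsModel A G → leibniz A G a b := by
  constructor
  · intro h G hFG hG
    have hle : l.suszko A F ≤ leibniz A G := sInf_le ⟨G, hFG, hG, rfl⟩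
    exact hle h
  · rintro h _ ⟨G, hFG, hG, rfl⟩
    exact h G hFG hG

theorem IsReducedModel.eq {A : Alg l.lang} {F : Set A.carrier} (h : l.IsReducedModel A F)
    {a b : A.carrier} (hab : ∀ G, F ⊆ G → l.IsModel A G → leibniz A G a b) : a = b := by
  have := suszko_iff.2 hab
  rw [h.2] at this
  exact this

/-- The two algebras are equal but not definitionally, so F is transported along a heterogeneous
equality. -/
theorem isReducedModel_comp {L' L'' : FirstOrder.Language.{u, 0}} [IsAlgebraicLanguage L']
    (τ : Translation l.lang L') (ρ : Translation L' L'') (A : Alg L'') (F : Set A.carrier)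
    (h : l.IsReducedModel (τ.reduct (ρ.reduct A)) F) :
    l.IsReducedModel ((τ.comp ρ).reduct A) F := by
  have key : ∀ B : Alg l.lang, B = τ.reduct (ρ.reduct A) → ∀ G : Set B.carrier, HEq G F →
      l.IsReducedModel B G := by
    rintro B rfl G hG
    rw [eq_of_heq hG]
    exact h
  exact key _ (reduct_comp τ ρ A) F HEq.rfl

theorem isReducedModel_of_forall {A : Alg l.lang} {F : Set A.carrier} (h : l.IsModel A F)
    (H : ∀ a b, (∀ G, F ⊆ G → l.IsModel A G → leibniz A G a b) → a = b) :
    l.IsReducedModel A F :=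
  ⟨h, eq_bot_iff.2 fun a b hab => H a b (suszko_iff.1 hab)⟩

/-- A Leibniz-reduced model is Suszko-reduced. -/
theorem isReducedModel_of_leibniz {A : Alg l.lang} {F : Set A.carrier} (h : l.IsModel A F)
    (H : ∀ a b, leibniz A F a b → a = b) : l.IsReducedModel A F :=
  isReducedModel_of_forall h fun a b hab => H a b (hab F subset_rfl h)

/-- Interpretations speak only of reduced models; this is how they give information about arbitrary
ones. -/
theorem IsModel.quotient {A : Alg l.lang} {F : Set A.carrier} (h : l.IsModel A F) :
    l.IsReducedModel (quotientAlg A (leibniz A F)) (Quotient.mk (leibniz A F) '' F) := by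
  refine isReducedModel_of_leibniz ?_ fun a b hab => ?_
  · intro Γ φ hΓ v hv
    obtain ⟨w, rfl⟩ : ∃ w : l.Var → A.carrier, v = fun x => Quotient.mk (leibniz A F) (w x) :=
      ⟨fun x => Quotient.out (v x), funext fun x => (Quotient.out_eq (v x)).symm⟩
    have hc := leibniz_isCongruence A F
    have e := fun t : l.lang.Term l.Var => realize_quotientAlg hc t w
    rw [e]
    refine ⟨_, h Γ φ hΓ w fun γ hγ => ?_, rfl⟩
    have := hv γ hγ
    rw [e] at this
    exact (mk_mem_image_iff (leibniz_isCompatible A F)).1 this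
  · rw [leibniz_quotientAlg] at hab
    exact hab

/-- The logic of a class of matrices. -/
abbrev ofMatrices (L : FirstOrder.Language.{u, 0}) [hL : IsAlgebraicLanguage L] (V : Type u)
    [hV : Infinite V] (K : ∀ A : Alg L, Set A.carrier → Prop) : Logic.{u} where
  lang := L
  algebraic := hL
  Var := V
  infiniteVar := hV
  Entails Γ φ := ∀ (A : Alg L) (F : Set A.carrier), K A F → ∀ v : V → A.carrier,
    (∀ γ ∈ Γ, γ.realize v ∈ F) → φ.realize v ∈ F
  refl h _ _ _ _ hv := hv _ h
  cut h hφ A F hA v hv := hφ A F hA v fun ψ hψ => h ψ hψ A F hA v hv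
  structural {Γ φ} σ h A F hA v hv := by
    rw [Term.realize_subst]
    refine h A F hA _ fun γ hγ => ?_
    rw [← Term.realize_subst]
    exact hv _ ⟨γ, hγ, rfl⟩

section Matrices

variable {L : FirstOrder.Language.{u, 0}} [IsAlgebraicLanguage L] {V : Type u} [Infinite V]
  {K : ∀ A : Alg L, Set A.carrier → Prop}

theorem isModel_ofMatrices {A : Alg L} {F : Set A.carrier} (h : K A F) :
    (ofMatrices L V K).IsModel A F := fun _ _ hΓ v hv => hΓ A F h v hv

/-- Valid one-premise rules transfer from the defining matrices to all models, whatever the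
variables in which they are written. -/
theorem IsModel.transfer {B : Alg L} {G : Set B.carrier} (hG : (ofMatrices L V K).IsModel B G)
    {X : Type*} (P Q : L.Term X)
    (h : ∀ A F, K A F → ∀ v : X → A.carrier, P.realize v ∈ F → Q.realize v ∈ F)
    (w : X → B.carrier) (hP : P.realize w ∈ G) : Q.realize w ∈ G := by
  classical
  -- Only finitely many variables occur, so they embed into V however large X is.
  let S := P.varFinset ∪ Q.varFinset
  obtain ⟨e⟩ : Nonempty (S ↪ V) :=
    ⟨(Fintype.equivFin S).toEmbedding.trans
      (Fin.valEmbedding.trans (Infinite.natEmbedding V))⟩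
  let v₀ : V := Infinite.natEmbedding V 0
  let g : X → V := fun x => if hx : x ∈ S then e ⟨x, hx⟩ else v₀
  let w' : V → B.carrier := fun y =>
    if hy : ∃ s : S, e s = y then w (Classical.choose hy : S) else Classical.arbitrary _
  have hw : ∀ x ∈ S, w' (g x) = w x := by
    intro x hx
    have hy : ∃ s : S, e s = g x := ⟨⟨x, hx⟩, by simp [g, hx]⟩
    have hs : Classical.choose hy = ⟨x, hx⟩ := by
      apply e.injective
      rw [Classical.choose_spec hy]
      simp [g, hx]
    simp only [w', hy, dite_true]
    exact congrArg (fun s : S => w s) hs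
  have hent : (ofMatrices L V K).Entails {P.relabel g} (Q.relabel g) := by
    intro A F hA v hv
    rw [Term.realize_relabel]
    apply h A F hA
    rw [← Term.realize_relabel]
    exact hv _ rfl
  have key := hG _ _ hent w'
  rw [Term.realize_relabel, realize_congr_varFinset B Q (v := w' ∘ g) (w := w)
    fun x hx => hw x (Finset.mem_union_right _ hx)] at key
  refine key ?_
  rintro _ rfl
  rwa [Term.realize_relabel, realize_congr_varFinset B P (v := w' ∘ g) (w := w)
    fun x hx => hw x (Finset.mem_union_left _ hx)]

/-- Identities valid in the algebras of the defining matrices hold in all reduced models. -/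
theorem IsReducedModel.realize_eq {B : Alg L} {F : Set B.carrier}
    (hB : (ofMatrices L V K).IsReducedModel B F) {X : Type*} (s t : L.Term X)
    (h : ∀ A F, K A F → ∀ v : X → A.carrier, s.realize v = t.realize v) (w : X → B.carrier) :
    s.realize w = t.realize w := by
  refine IsReducedModel.eq hB fun G _ hG => ?_
  rw [leibniz_eq_polyEquiv]
  intro p
  -- The parameters of p become variables, so p(s) = p(t) is an identity between terms and the rules
  -- p(s) ▷ p(t) and p(t) ▷ p(s) can be transferred.
  let inst (r : L.Term X) : L.Term (X ⊕ B.carrier) :=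
    p.subst fun o => o.elim (r.relabel Sum.inl) fun c => .var (.inr c)
  have hinst : ∀ (A : Alg L) (r : L.Term X) (v : X ⊕ B.carrier → A.carrier),
      (inst r).realize v = p.realize fun o => o.elim (r.realize (v ∘ Sum.inl)) (v ∘ Sum.inr) := by
    intro A r v
    simp only [inst, Term.realize_subst]
    congr 1
    funext o
    cases o with
    | none => simp [Option.elim]
    | some c => rfl
  have hpoly : ∀ r : L.Term X, polyEval B p (r.realize w) = (inst r).realize (Sum.elim w id) := by
    intro r
    rw [hinst]
    rfl
  have heq : ∀ A F, K A F → ∀ v : X ⊕ B.carrier → A.carrier,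
      (inst s).realize v = (inst t).realize v := by
    intro A F hA v
    rw [hinst, hinst, h A F hA]
  rw [hpoly, hpoly]
  exact ⟨hG.transfer _ _ (fun A F hA v hv => heq A F hA v ▸ hv) _,
    hG.transfer _ _ (fun A F hA v hv => (heq A F hA v).symm ▸ hv) _⟩

end Matrices

end Logic

/-! ### Basic equivalential logics -/

section BasicEquivalential

variable {κ : Cardinal.{u}}

/-- The interpretation of `⊸_α` in an algebra. -/
def eqOp (A : Alg (eqLang κ)) (α : κ.out) (a b : A.carrier) : A.carrier :=
  Structure.funMap (eqSymbol α) ![a, b]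

theorem realize_lolli (A : Alg (eqLang κ)) (α : κ.out) (φ ψ : EqFm κ)
    (v : ULift.{u} ℕ → A.carrier) :
    (lolli α φ ψ).realize v = eqOp A α (φ.realize v) (ψ.realize v) :=
  Term.realize_functions_apply₂

theorem isModel_ofRules {L : FirstOrder.Language.{u, 0}} [IsAlgebraicLanguage L] {V : Type u}
    [Infinite V] {R : Set (Set (L.Term V) × L.Term V)} {A : Alg L} {F : Set A.carrier} :
    (Logic.ofRules L V R).IsModel A F ↔ ∀ r ∈ R, ∀ v : V → A.carrier,
      (∀ ψ ∈ r.1, ψ.realize v ∈ F) → r.2.realize v ∈ F := by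
  have hsub : ∀ t : L.Term V, t.subst .var = t := by
    intro t
    induction t with
    | var x => rfl
    | func f ts ih => simp only [Term.subst, ih]
  constructor
  · intro h r hr v hv
    refine h r.1 r.2 ?_ v hv
    rw [← hsub r.2]
    refine Derivable.rule r.1 r.2 .var hr fun ψ hψ => ?_
    rw [hsub]
    exact Derivable.hyp _ hψ
  · intro h Γ φ hφ v hv
    change Derivable R Γ φ at hφ
    induction hφ with
    | hyp φ hφ => exact hv φ hφ
    | rule Δ φ σ hR _ ih =>
      rw [Term.realize_subst]
      refine h _ hR _ fun ψ hψ => ?_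
      rw [← Term.realize_subst]
      exact ih ψ hψ

theorem isModel_basicEquivalential {A : Alg (eqLang κ)} {F : Set A.carrier} :
    (basicEquivalential κ).IsModel A F ↔
      (∀ a α, eqOp A α a a ∈ F) ∧
      (∀ a b, a ∈ F → (∀ α, eqOp A α a b ∈ F) → b ∈ F) ∧
      ∀ a b c d, (∀ α, eqOp A α a b ∈ F) → (∀ α, eqOp A α c d ∈ F) →
        ∀ α β, eqOp A β (eqOp A α a c) (eqOp A α b d) ∈ F := by
  have hvar : ∀ (v : ULift.{u} ℕ → A.carrier) (i : ℕ),
      (eqVar i : EqFm κ).realize v = v (ULift.up i) := fun _ _ => rfl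
  rw [isModel_ofRules]
  constructor
  · intro h
    refine ⟨fun a α => ?_, fun a b ha hab => ?_, fun a b c d hab hcd α β => ?_⟩
    · have := h _ (EqRules.refl _ ⟨α, rfl⟩) (fun _ => a) (fun _ h => h.elim)
      rwa [realize_lolli] at this
    · refine h _ EqRules.detach (fun i => if i.down = 0 then a else b) ?_
      rintro _ (rfl | ⟨α, rfl⟩)
      · exact ha
      · rw [realize_lolli]
        exact hab α
    · have := h _ (EqRules.replace α _ ⟨β, rfl⟩) (fun i => if i.down = 0 then a else
        if i.down = 1 then b else if i.down = 2 then c else d) ?_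
      · simpa [realize_lolli, hvar] using this
      · rintro _ (⟨α, rfl⟩ | ⟨α, rfl⟩)
        · simpa [realize_lolli, hvar] using hab α
        · simpa [realize_lolli, hvar] using hcd α
  · rintro ⟨h₁, h₂, h₃⟩ r hr v hv
    cases hr with
    | refl δ hδ =>
      obtain ⟨α, rfl⟩ := hδ
      rw [realize_lolli]
      exact h₁ _ _
    | detach =>
      refine h₂ _ _ (hv (eqVar 0) (Or.inl rfl)) fun α => ?_
      have := hv _ (Or.inr ⟨α, rfl⟩)
      rwa [realize_lolli] at this
    | replace α δ hδ =>
      obtain ⟨β, rfl⟩ := hδ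
      rw [realize_lolli, realize_lolli, realize_lolli]
      refine h₃ _ _ _ _ (fun α => ?_) (fun α => ?_) α β
      · have := hv _ (Or.inl ⟨α, rfl⟩)
        rwa [realize_lolli] at this
      · have := hv _ (Or.inr ⟨α, rfl⟩)
        rwa [realize_lolli] at this

theorem leibniz_of_isModel_basicEquivalential [Nonempty κ.out] {A : Alg (eqLang κ)}
    {F : Set A.carrier} (h : (basicEquivalential κ).IsModel A F) {a b : A.carrier} :
    leibniz A F a b ↔ ∀ α, eqOp A α a b ∈ F := by
  obtain ⟨h₁, h₂, h₃⟩ := isModel_basicEquivalential.1 h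
  constructor
  · intro hab α
    refine leibniz_isCompatible A F _ _ ?_ (h₁ a α)
    refine leibniz_isCongruence A F 2 (eqSymbol α) _ _ fun i => ?_
    fin_cases i
    · exact (leibniz A F).refl a
    · exact hab
  -- Replacement applied to Δ(a, b) and Δ(a, a) gives Δ(a ⊸ a, b ⊸ a); as a ⊸ a is in F, detachment
  -- gives b ⊸ a. Transitivity below uses Δ(a ⊸ b, a ⊸ c) in the same way.
  · have hsymm : ∀ {a b}, (∀ α, eqOp A α a b ∈ F) → ∀ α, eqOp A α b a ∈ F :=
      fun {a b} hab α => h₂ _ _ (h₁ a α) (h₃ a b a a hab (h₁ a) α)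
    let θ : Setoid A.carrier :=
      { r := fun a b => ∀ α, eqOp A α a b ∈ F
        iseqv := ⟨h₁, hsymm, fun {a b c} hab hbc α =>
          h₂ _ _ (hab α) (h₃ a a b c (h₁ a) hbc α)⟩ }
    have hθ : θ ≤ leibniz A F := by
      refine le_leibniz ?_ fun a b hab ha => h₂ a b ha hab
      rintro (_ | _ | _ | n) f x y hxy
      · exact f.elim
      · exact f.elim
      · have hx : ∀ x : Fin 2 → A.carrier, Structure.funMap f x = eqOp A f (x 0) (x 1) := by
          intro x
          refine congrArg (Structure.funMap f) (funext fun i => ?_)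
          fin_cases i <;> rfl
        rw [hx, hx]
        exact h₃ _ _ _ _ (hxy 0) (hxy 1) f
      · exact f.elim
    exact fun hab => hθ hab

/-- The condition Δ(a, b) ⊆ F persists in larger filters, so it puts (a, b) in the Suszko
congruence. Conversely, if it means a = b, the rules hold because equality is a congruence. -/
theorem isReducedModel_basicEquivalential [Nonempty κ.out] {A : Alg (eqLang κ)}
    {F : Set A.carrier} :
    (basicEquivalential κ).IsReducedModel A F ↔ ∀ a b, (∀ α, eqOp A α a b ∈ F) ↔ a = b := by
  constructor
  · intro h a b
    obtain ⟨h₁, -, -⟩ := isModel_basicEquivalential.1 h.1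
    refine ⟨fun hab => h.eq fun G hFG hG => ?_, fun hab α => hab ▸ h₁ a α⟩
    exact (leibniz_of_isModel_basicEquivalential hG).2 fun α => hFG (hab α)
  · intro h
    have hm : (basicEquivalential κ).IsModel A F := by
      rw [isModel_basicEquivalential]
      refine ⟨fun a α => (h a a).2 rfl α, fun a b ha hab => (h a b).1 hab ▸ ha,
        fun a b c d hab hcd α β => ?_⟩
      rw [(h a b).1 hab, (h c d).1 hcd]
      exact (h _ _).2 rfl β
    exact Logic.isReducedModel_of_leibniz hm fun a b hab =>
      (h a b).1 ((leibniz_of_isModel_basicEquivalential hm).1 hab)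

/-- A translation out of the language of a basic equivalential logic is given by a family of
binary formulas. -/
def eqTranslation {L : FirstOrder.Language.{u, 0}} (s : κ.out → L.Term (Fin 2)) :
    Translation (eqLang κ) L
  | 0, f => PEmpty.elim f
  | 1, f => PEmpty.elim f
  | 2, f => s f
  | _ + 3, f => PEmpty.elim f

/-- The basic equivalential logic is interpretable into a logic by a family of binary formulas
that defines Leibniz congruences. -/
theorem basicEquivalential_le [Nonempty κ.out] {l : Logic.{u}} (s : κ.out → l.lang.Term (Fin 2))
    (hs : ∀ (A : Alg l.lang) (F : Set A.carrier), l.IsModel A F → ∀ a b : A.carrier,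
      leibniz A F a b ↔ ∀ α, (s α).realize ![a, b] ∈ F) : basicEquivalential κ ≤ l := by
  refine ⟨eqTranslation s, fun A F h => ?_⟩
  refine isReducedModel_basicEquivalential.2 fun (a b : A.carrier) => ?_
  change (∀ α, (s α).realize ![a, b] ∈ F) ↔ a = b
  constructor
  · exact fun hab => h.eq fun G hFG hG => (hs A G hG a b).2 fun α => hFG (hab α)
  · rintro rfl
    exact (hs A F h.1 a a).1 ((leibniz A F).refl a)

/-- A surjection from κ' onto κ lists the symbols of rank κ with repetitions, and the repeated
family defines the same congruences. -/
theorem basicEquivalential_anti {κ κ' : Cardinal.{u}} [Nonempty κ.out] (h : κ ≤ κ') :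
    basicEquivalential κ' ≤ basicEquivalential κ := by
  obtain ⟨e⟩ : Nonempty (κ.out ↪ κ'.out) := by
    rwa [← Cardinal.le_def, Cardinal.mk_out, Cardinal.mk_out]
  have hsurj := Function.invFun_surjective e.injective
  have : Nonempty κ'.out := ‹Nonempty κ.out›.map e
  refine basicEquivalential_le
    (fun α => (eqSymbol (Function.invFun e α)).apply₂ (.var 0) (.var 1)) fun A F hF a b => ?_
  rw [leibniz_of_isModel_basicEquivalential hF]
  have hr : ∀ α : κ.out, ((eqSymbol α).apply₂ (.var 0) (.var 1) :
      (eqLang κ).Term (Fin 2)).realize ![a, b] = eqOp A α a b := fun α =>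
    Term.realize_functions_apply₂
  constructor
  · intro hab α
    rw [hr]
    exact hab _
  · intro hab α
    obtain ⟨β, rfl⟩ := hsurj α
    rw [← hr]
    exact hab β

/-- The translated symbols define equality in the reduced quotient of a model, hence the Leibniz
congruence in the model itself. -/
theorem Logic.equivalential_of_le [Nonempty κ.out] {l : Logic.{u}}
    (h : basicEquivalential κ ≤ l) : l.Equivalential := by
  obtain ⟨τ, hτ⟩ := h
  refine ⟨Set.range fun α : κ.out => τ 2 (eqSymbol α), Set.range_nonempty _,
    fun A F hF a b => ?_⟩
  have hc := leibniz_isCongruence A F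
  have hr := isReducedModel_basicEquivalential.1 (hτ _ _ hF.quotient)
    (Quotient.mk (leibniz A F) a) (Quotient.mk (leibniz A F) b)
  refine (Quotient.eq.symm.trans hr.symm).trans
    (Iff.trans (forall_congr' fun α => ?_) Set.forall_mem_range.symm)
  rw [← mk_mem_image_iff (leibniz_isCompatible A F), ← realize_quotientAlg hc]
  refine iff_of_eq (congrArg (· ∈ Quotient.mk (leibniz A F) '' F) ?_)
  refine congrArg (fun v => Term.realize (M := (quotientAlg A (leibniz A F)).carrier) v
    (τ 2 (eqSymbol α))) (funext fun i => ?_)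
  fin_cases i <;> rfl

theorem Logic.Equivalential.exists_le {l : Logic.{u}} (h : l.Equivalential) :
    ∃ α : Ordinal.{u}, basicEquivalential (Cardinal.aleph α) ≤ l := by
  obtain ⟨Δ, hne, hΔ⟩ := h
  obtain ⟨α, hα⟩ : ∃ α : Ordinal.{u}, Cardinal.mk Δ ≤ Cardinal.aleph α := by
    -- The alephs are the infinite cardinals, and Δ may be finite.
    obtain ⟨α, hα⟩ := Cardinal.mem_range_aleph_iff.2 (le_max_left Cardinal.aleph0 (Cardinal.mk Δ))
    exact ⟨α, hα ▸ le_max_right _ _⟩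
  obtain ⟨e⟩ : Nonempty (Δ ↪ (Cardinal.aleph α).out) := by
    rwa [← Cardinal.le_def, Cardinal.mk_out]
  have : Nonempty Δ := hne.to_subtype
  have : Nonempty (Cardinal.aleph α).out := ‹Nonempty Δ›.map e
  have hsurj := Function.invFun_surjective e.injective
  refine ⟨α, basicEquivalential_le (fun i => (Function.invFun e i : Δ)) fun A F hF a b => ?_⟩
  rw [hΔ A F hF, ← hsurj.forall (p := fun δ : Δ => δ.1.realize ![a, b] ∈ F), Subtype.forall]

/-! ### Idempotent terms -/

/-- The algebra of terms. -/
def termAlg (L : FirstOrder.Language.{u, 0}) [IsAlgebraicLanguage L] (X : Type u) [Nonempty X] :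
    Alg L where
  carrier := L.Term X
  nonempty := ‹Nonempty X›.map .var
  str :=
    { funMap := fun f ts => .func f ts
      RelMap := fun {n} r => ((IsAlgebraicLanguage.noRelations (L := L) n).false r).elim }

theorem realize_termAlg {L : FirstOrder.Language.{u, 0}} [IsAlgebraicLanguage L] {X : Type u}
    [Nonempty X] {Y : Type*} (t : L.Term Y) (σ : Y → L.Term X) :
    t.realize (M := (termAlg L X).carrier) σ = t.subst σ := by
  induction t with
  | var x => rfl
  | func f ts ih => exact congrArg (Term.func f) (funext ih)

/-- The terms of the form `φ ⊸_α φ` make the term algebra a reduced model. -/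
theorem isReducedModel_termAlg [Nonempty κ.out] (X : Type u) [Nonempty X] :
    (basicEquivalential κ).IsReducedModel (termAlg (eqLang κ) X)
      {t : (eqLang κ).Term X | ∃ (α : κ.out) (φ : (eqLang κ).Term X),
        t = .func (eqSymbol α) ![φ, φ]} := by
  rw [isReducedModel_basicEquivalential]
  intro a b
  constructor
  · intro h
    -- One symbol suffices: by unique readability a ⊸ b has the form φ ⊸ φ only if a = b.
    obtain ⟨α, φ, hφ⟩ := h (Classical.arbitrary _)
    change Term.func (eqSymbol _) ![a, b] = Term.func (eqSymbol α) ![φ, φ] at hφ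
    injection hφ with _ _ hts
    have h₀ : a = φ := congrFun hts 0
    have h₁ : b = φ := congrFun hts 1
    exact h₀.trans h₁.symm
  · rintro rfl α
    exact ⟨α, a, rfl⟩

/-- A binary term that is idempotent in all reduced models is a variable. -/
theorem eq_var_of_idempotent [Nonempty κ.out] (t : (eqLang κ).Term (Fin 2))
    (ht : ∀ (A : Alg (eqLang κ)) (F : Set A.carrier), (basicEquivalential κ).IsReducedModel A F →
      ∀ a : A.carrier, t.realize (fun _ => a) = a) : ∃ i, t = .var i := by
  -- Over a single generator idempotence says that t, with both variables identified, is that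
  -- generator; a compound term stays compound.
  have h := ht _ _ (isReducedModel_termAlg PUnit) (.var PUnit.unit : (eqLang κ).Term PUnit)
  rw [realize_termAlg] at h
  cases t with
  | var i => exact ⟨i, rfl⟩
  | func f ts => cases h

end BasicEquivalential

/-! ### A lower bound of two logics -/

section Meet

/-- The operation symbols of the meet of two logics: the operation symbols of each of them and a
binary symbol, which will select the first argument in the first logic and the second argument in
the second one. -/
inductive MeetFunctions (L : Fin 2 → FirstOrder.Language.{u, 0}) : ℕ → Type u
  | op (j : Fin 2) {n : ℕ} (f : (L j).Functions (n + 1)) : MeetFunctions L (n + 1)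
  | diag : MeetFunctions L 2

/-- The language of the meet of two logics. -/
def meetLang (L : Fin 2 → FirstOrder.Language.{u, 0}) : FirstOrder.Language.{u, 0} where
  Functions := MeetFunctions L
  Relations := fun _ => Empty

/-- The operation symbol of the meet that comes from `f`. -/
def meetOp {L : Fin 2 → FirstOrder.Language.{u, 0}} (j : Fin 2) {n : ℕ}
    (f : (L j).Functions (n + 1)) : (meetLang L).Functions (n + 1) :=
  MeetFunctions.op j f

/-- The additional binary symbol of the meet. -/
def meetDiag {L : Fin 2 → FirstOrder.Language.{u, 0}} : (meetLang L).Functions 2 :=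
  MeetFunctions.diag

instance (L : Fin 2 → FirstOrder.Language.{u, 0}) : IsAlgebraicLanguage (meetLang L) where
  noRelations := fun _ => inferInstanceAs (IsEmpty Empty)
  noConstants := ⟨fun f => nomatch (f : MeetFunctions L 0)⟩

/-- The translation of the language of the meet into that of the `i`-th logic, in which the
operation symbols of the other logic become the first projection. -/
def meetProj (L : Fin 2 → FirstOrder.Language.{u, 0}) (i : Fin 2) :
    Translation (meetLang L) (L i)
  -- All arities are positive, so a first argument exists.
  | _, .op j f => if h : j = i then .func (h ▸ f) .var else .var 0
  | _, .diag => .var i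

/-- The translation of the language of the `i`-th logic into that of the meet. -/
def meetIncl (L : Fin 2 → FirstOrder.Language.{u, 0}) (i : Fin 2) [IsAlgebraicLanguage (L i)] :
    Translation (L i) (meetLang L)
  | 0, f => (IsAlgebraicLanguage.noConstants.false f).elim
  | _ + 1, f => .func (meetOp i f) .var

section Projections

variable {L : Fin 2 → FirstOrder.Language.{u, 0}} {i j : Fin 2}

theorem meetProj_op_self {n : ℕ} (f : (L i).Functions (n + 1)) :
    meetProj L i _ (meetOp i f) = .func f .var := by
  simp [meetProj, meetOp]

theorem meetProj_op_of_ne (h : j ≠ i) {n : ℕ} (f : (L j).Functions (n + 1)) :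
    meetProj L i _ (meetOp j f) = .var 0 := by
  simp [meetProj, meetOp, h]

variable (A : Alg (L i))

theorem funMap_op_self {n : ℕ} (f : (L i).Functions (n + 1)) (x : Fin (n + 1) → A.carrier) :
    Structure.funMap (M := ((meetProj L i).reduct A).carrier) (meetOp (L := L) i f) x =
      Structure.funMap (M := A.carrier) f x :=
  congrArg (Term.realize (M := A.carrier) x) (meetProj_op_self f)

theorem funMap_op_of_ne (h : j ≠ i) {n : ℕ} (f : (L j).Functions (n + 1))
    (x : Fin (n + 1) → A.carrier) :
    Structure.funMap (M := ((meetProj L i).reduct A).carrier) (meetOp (L := L) j f) x = x 0 :=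
  congrArg (Term.realize (M := A.carrier) x) (meetProj_op_of_ne h f)

theorem funMap_diag (x : Fin 2 → ((meetProj L i).reduct A).carrier) :
    Structure.funMap (M := ((meetProj L i).reduct A).carrier)
      (meetDiag (L := L)) x = x i := rfl

end Projections

/-- The translation of a formula of the `i`-th logic into the language of the meet, with a
parameter `none` which is its value in the other logic. -/
def meetLift {L : Fin 2 → FirstOrder.Language.{u, 0}} {i : Fin 2} [IsAlgebraicLanguage (L i)]
    {V W : Type*} (e : V → W) (t : (L i).Term V) : (meetLang L).Term (Option W) :=
  (t.substFunc fun {n} f => meetIncl L i n f).subst fun x =>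
    .func (meetDiag (L := L))
      fun k => if k = i then .var (some (e x)) else .var none

section Lift

variable {L : Fin 2 → FirstOrder.Language.{u, 0}} {i : Fin 2} [IsAlgebraicLanguage (L i)]
  {V W : Type*} (e : V → W) (t : (L i).Term V)

theorem realize_meetLift_of_diag (B : Alg (meetLang L))
    (hB : ∀ x : Fin 2 → B.carrier,
      Structure.funMap (meetDiag (L := L)) x = x i)
    (v : Option W → B.carrier) :
    (meetLift e t).realize v =
      t.realize (M := ((meetIncl L i).reduct B).carrier) fun x => v (some (e x)) := by
  rw [meetLift, Term.realize_subst, realize_substFunc_reduct]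
  congr 1
  funext x
  rw [Term.realize_func, hB, if_pos rfl]
  rfl

theorem realize_meetLift_self (A : Alg (L i)) (v : Option W → A.carrier) :
    (meetLift e t).realize (M := ((meetProj L i).reduct A).carrier) v =
      Term.realize (M := A.carrier) (fun x => v (some (e x))) t := by
  refine (realize_meetLift_of_diag _ _ _ (funMap_diag A) v).trans ?_
  induction t with
  | var x => rfl
  | @func n f ts ih =>
    cases n with
    | zero => exact (IsAlgebraicLanguage.noConstants.false f).elim
    | succ n =>
      exact (funMap_op_self A f _).trans
        (congrArg (Structure.funMap (M := A.carrier) f) (funext ih))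

/-- Foreign symbols are first projections, so evaluation follows the leftmost branch to a leaf,
where `diag` selects `none`. -/
theorem realize_meetLift_of_ne {j : Fin 2} (h : i ≠ j) (A : Alg (L j))
    (v : Option W → ((meetProj L j).reduct A).carrier) :
    (meetLift e t).realize (M := ((meetProj L j).reduct A).carrier) v = v none := by
  rw [meetLift, Term.realize_subst, realize_substFunc_reduct]
  induction t with
  | var x =>
    have e₀ : (if j = i then .var (some (e x)) else .var none :
        (meetLang L).Term (Option W)) = .var none := if_neg h.symm
    exact congrArg (Term.realize (M := ((meetProj L j).reduct A).carrier) v) e₀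
  | @func n f ts ih =>
    cases n with
    | zero => exact (IsAlgebraicLanguage.noConstants.false f).elim
    | succ n => exact (funMap_op_of_ne A h f _).trans (ih 0)

end Lift

variable (l : Fin 2 → Logic.{u})

/-- The matrices that determine the meet of two logics. -/
inductive MeetMatrix : ∀ A : Alg (meetLang fun i => (l i).lang), Set A.carrier → Prop
  | mk (i : Fin 2) (A : Alg (l i).lang) (F : Set A.carrier) : (l i).IsModel A F →
      MeetMatrix ((meetProj (fun i => (l i).lang) i).reduct A) F

/-- The variables of both logics, and one more to serve as the parameter of `meetLift`. -/
instance : Infinite (Option (Σ i, (l i).Var)) :=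
  Infinite.of_injective (fun x => some (⟨0, x⟩ : Σ i, (l i).Var)) fun x y h => by simpa using h

/-- A lower bound of the logics `l 0` and `l 1`. -/
abbrev meetLogic : Logic.{u} :=
  Logic.ofMatrices (meetLang fun i => (l i).lang) (Option (Σ i, (l i).Var)) (MeetMatrix l)

/-- Filters of `l i` are filters of the lower bound by definition, and the symbols of `l i` are
retained, so congruences of the reduct are congruences of A. -/
theorem meetLogic_le (i : Fin 2) : meetLogic l ≤ l i := by
  refine ⟨meetProj (fun i => (l i).lang) i, fun A F h => ?_⟩
  refine Logic.isReducedModel_of_forall (Logic.isModel_ofMatrices (.mk i A F h.1))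
    fun a b hab => h.eq fun G hFG hG => ?_
  have hle : leibniz ((meetProj (fun i => (l i).lang) i).reduct A) G ≤ leibniz A G := by
    refine le_leibniz (A := A) ?_
      (leibniz_isCompatible ((meetProj (fun i => (l i).lang) i).reduct A) G)
    rintro (_ | n) f x y hxy
    · exact ((l i).algebraic.noConstants.false f).elim
    · have hc := leibniz_isCongruence ((meetProj (fun i => (l i).lang) i).reduct A) G (n + 1)
        (meetOp (L := fun i => (l i).lang) i f) x y hxy
      have e := funMap_op_self (L := fun i => (l i).lang) A f
      exact e x ▸ e y ▸ hc
  exact hle (hab G hFG (Logic.isModel_ofMatrices (.mk i A G hG)))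

variable {l} {i : Fin 2} {B : Alg (meetLang fun i => (l i).lang)} {F : Set B.carrier}

/-- If Γ entails φ in `l i`, then `none` and the lifts of Γ entail the lift of φ in the lower bound:
on matrices from the other logic the conclusion takes the value of `none`. Nonemptiness of F
supplies a value in F for `none`. -/
theorem isModel_meetIncl
    (hdiag : ∀ x : Fin 2 → B.carrier,
      Structure.funMap (meetDiag (L := fun i => (l i).lang)) x = x i)
    (hF : (meetLogic l).IsModel B F) (hne : F.Nonempty) :
    (l i).IsModel ((meetIncl (fun i => (l i).lang) i).reduct B) F := by
  classical
  intro Γ φ hΓ v hv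
  obtain ⟨a, ha⟩ := hne
  let w : Option (Σ i, (l i).Var) → B.carrier := fun o => o.elim a fun s =>
    if h : s.1 = i then v (h ▸ s.2) else a
  have hw : (fun x => w (some ⟨i, x⟩)) = v := by
    funext x
    exact dif_pos rfl
  have key := hF (insert (.var none) (meetLift (Sigma.mk i) '' Γ)) (meetLift (Sigma.mk i) φ) ?_ w ?_
  · rw [realize_meetLift_of_diag _ _ _ hdiag, hw] at key
    exact key
  · rintro _ _ ⟨j, A, G, hG⟩ u hu
    by_cases hj : i = j
    · subst hj
      have e := fun t => realize_meetLift_self (L := fun i => (l i).lang) (Sigma.mk i) t A u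
      refine (e φ).symm ▸ hG Γ φ hΓ _ fun γ hγ => ?_
      exact e γ ▸ hu _ (Or.inr ⟨γ, hγ, rfl⟩)
    · have e := realize_meetLift_of_ne (L := fun i => (l i).lang) (Sigma.mk i) φ hj A u
      exact e.symm ▸ hu _ (Or.inl rfl)
  · rintro _ (rfl | ⟨γ, hγ, rfl⟩)
    · exact ha
    · rw [realize_meetLift_of_diag _ _ _ hdiag, hw]
      exact hv γ hγ

/-- Let t be f applied to variables, and s be `diag` with t in place j and the first variable in the
other. Then s = t in all defining matrices: those of `l j` select t, and in the others t is its
first variable. Where `diag` selects i ≠ j, s is the first variable. -/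
theorem funMap_op_of_diag
    (hdiag : ∀ x : Fin 2 → B.carrier,
      Structure.funMap (meetDiag (L := fun i => (l i).lang)) x = x i)
    (hF : (meetLogic l).IsReducedModel B F) {j : Fin 2} (hj : j ≠ i) {n : ℕ}
    (f : (l j).lang.Functions (n + 1)) (x : Fin (n + 1) → B.carrier) :
    Structure.funMap
      (meetOp (L := fun i => (l i).lang) j f) x = x 0 := by
  let t : (meetLang fun i => (l i).lang).Term (Fin (n + 1)) := .func (meetOp (L := fun i => (l i).lang) j f) .var
  let s : (meetLang fun i => (l i).lang).Term (Fin (n + 1)) :=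
    .func meetDiag fun k => if k = j then t else .var 0
  have hst : s.realize x = t.realize x := by
    refine hF.realize_eq s t ?_ x
    rintro _ _ ⟨k, A, G, -⟩ v
    simp only [s, Term.realize_func, funMap_diag]
    split_ifs with hk
    · rfl
    · exact (funMap_op_of_ne (L := fun i => (l i).lang) A (Ne.symm hk) f _).symm
  simp only [s, Term.realize_func, hdiag, if_neg hj.symm] at hst
  exact hst.symm

/-- The symbols of B outside `l i` are projections, which preserve every equivalence relation, so
the reduct has no congruences beyond those of B. -/
theorem isReducedModel_meetIncl
    (hdiag : ∀ x : Fin 2 → B.carrier,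
      Structure.funMap (meetDiag (L := fun i => (l i).lang)) x = x i)
    (hF : (meetLogic l).IsReducedModel B F) (hne : F.Nonempty) :
    (l i).IsReducedModel ((meetIncl (fun i => (l i).lang) i).reduct B) F := by
  refine Logic.isReducedModel_of_forall (isModel_meetIncl hdiag hF.1 hne)
    fun a b hab => hF.eq fun G hFG hG => ?_
  have hle : leibniz ((meetIncl (fun i => (l i).lang) i).reduct B) G ≤ leibniz B G := by
    refine le_leibniz (A := B) ?_
      (leibniz_isCompatible ((meetIncl (fun i => (l i).lang) i).reduct B) G)
    intro n f x y hxy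
    cases f with
    | @op j n f =>
      by_cases hj : j = i
      · subst hj
        exact leibniz_isCongruence ((meetIncl (fun i => (l i).lang) j).reduct B) G (n + 1) f x y hxy
      · have e := funMap_op_of_diag hdiag hF hj f
        exact (e x).symm ▸ (e y).symm ▸ hxy 0
    | diag => exact (hdiag x).symm ▸ (hdiag y).symm ▸ hxy i
  exact hle (hab G hFG (isModel_meetIncl hdiag hG (hne.mono hFG)))

/-- If the meet is below a basic equivalential logic, then so is one of the two logics. -/
theorem exists_le_of_meetLogic_le {κ : Cardinal.{u}} [Nonempty κ.out]
    (h : meetLogic l ≤ basicEquivalential κ) : ∃ i, l i ≤ basicEquivalential κ := by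
  obtain ⟨τ, hτ⟩ := h
  -- The identity `diag(x, x) = x` holds in the defining matrices, whichever coordinate is selected.
  obtain ⟨i, hi⟩ := eq_var_of_idempotent (τ 2 meetDiag) fun A F hA a => by
    refine (hτ A F hA).realize_eq (X := Unit) (.func meetDiag fun _ => .var ()) (.var ()) ?_ fun _ => a
    rintro _ _ ⟨i, C, G, -⟩ v
    exact funMap_diag (L := fun i => (l i).lang) C fun _ => v ()
  refine ⟨i, (meetIncl (fun i => (l i).lang) i).comp τ, fun A F hA => ?_⟩
  refine Logic.isReducedModel_comp _ τ A F (isReducedModel_meetIncl ?_ (hτ A F hA) ?_)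
  · intro x
    exact congrArg (Term.realize (M := A.carrier) x) hi
  -- F contains a ⊸ a, hence is nonempty.
  · exact ⟨_, (isModel_basicEquivalential.1 hA.1).1 (Classical.arbitrary _)
      (Classical.arbitrary _)⟩

end Meet

/-! ### Meet-primeness and the Leibniz condition -/

/-- The basic equivalential logics are meet-prime. -/
theorem meetPrime_basicEquivalential (κ : Cardinal.{u}) [Nonempty κ.out] :
    (basicEquivalential κ).MeetPrime := by
  intro b c h
  induction b using Quotient.inductionOn with | _ l₀ => ?_
  induction c using Quotient.inductionOn with | _ l₁ => ?_
  have hle := h (toAntisymmetrization (· ≤ ·) (meetLogic ![l₀, l₁]))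
    (meetLogic_le ![l₀, l₁] 0) (meetLogic_le ![l₀, l₁] 1)
  obtain ⟨i, hi⟩ := exists_le_of_meetLogic_le hle
  fin_cases i
  · exact Or.inl hi
  · exact Or.inr hi

end AAL

theorem theorem7p7 :
    (∀ κ : Cardinal.{u}, Cardinal.aleph0 ≤ κ → (AAL.basicEquivalential κ).MeetPrime) ∧
    ∃ Φ : AAL.LeibnizCondition.{u},
      (∀ α : Ordinal.{u}, (Φ.seq α).MeetPrime) ∧
      Φ.Log = {l : AAL.Logic.{u} | l.Equivalential} := by
  have hne : ∀ κ : Cardinal.{u}, Cardinal.aleph0 ≤ κ → Nonempty κ.out := fun κ hκ => by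
    rw [← Cardinal.mk_ne_zero_iff, Cardinal.mk_out]
    exact (Cardinal.aleph0_pos.trans_le hκ).ne'
  have haleph : ∀ α : Ordinal.{u}, Nonempty (Cardinal.aleph α).out := fun α =>
    hne _ (Cardinal.aleph0_le_aleph α)
  refine ⟨fun κ hκ => ?_, ⟨fun α => AAL.basicEquivalential (Cardinal.aleph α), fun α β h =>
    AAL.basicEquivalential_anti (Cardinal.aleph_le_aleph.2 h)⟩,
    fun α => AAL.meetPrime_basicEquivalential _, ?_⟩
  · have := hne κ hκ
    exact AAL.meetPrime_basicEquivalential κ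
  · ext l
    exact ⟨fun ⟨_, h⟩ => AAL.Logic.equivalential_of_le h, fun h => h.exists_le⟩
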